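/- Let $\Omega \subset \mathbb{R}^d$ be open and let $H$ be a (real or complex) Hilbert space with inner product $(\cdot,\cdot)_H$. Let $H^1(\Omega,H)$ be the space of all $u \in L_2(\Omega,H)$ whose weak partial derivatives $\partial_1 u,\dots,\partial_d u$ exist and belong to $L_2(\Omega,H)$, where $\partial_k u$ is the (almost everywhere unique) function with $-\int_\Omega u \, \partial_k\varphi = \int_\Omega (\partial_k u)\,\varphi$ for all $\varphi \in C_c^\infty(\Omega)$. For $u \colon \Omega \to H$ define $\operatorname{sgn} u \colon \Omega \to H$ by $(\operatorname{sgn} u)(x) = \frac{1}{\|u(x)\|_H}\,u(x)$ if $u(x) \neq 0$ and $(\operatorname{sgn} u)(x) = 0$ if $u(x) = 0$. Let $u \in H^1(\Omega,H)$, $\alpha > 0$ and $M > 0$, and define $v = (\|u\|_H^\alpha \wedge M)\, u$, where $\wedge$ denotes the minimum. Then $v \in H^1(\Omega,H)$ and, for all $k \in \{1,\dots,d\}$, $$ \partial_k v = \alpha \, \mathbf{1}_{[\|u\|_H^\alpha < M]} \, \|u\|_H^\alpha \, \operatorname{Re}(\operatorname{sgn} u, \partial_k u)_H \, \operatorname{sgn}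 u + (\|u\|_H^\alpha \wedge M) \, \partial_k u $$ almost everywhere on $\Omega$. -/

import Mathlib

open MeasureTheory
open scoped ContDiff

/-- `g` is a weak `k`-th partial derivative of the `H`-valued function `u` on the set `Ω`
(in practice an open subset of `ℝᵈ`): both functions are locally (Bochner) integrable on `Ω` and
`-∫_Ω (∂ₖ φ) u = ∫_Ω φ g` for every real-valued test function `φ ∈ C_c^∞(Ω)`.
Only the values of `u` and `g` on `Ω` matter. -/
def HasWeakPartialDeriv {d : ℕ} {H : Type*} [NormedAddCommGroup H] [NormedSpace ℝ H]
    (Ω : Set (EuclideanSpace ℝ (Fin d))) (k : Fin d)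
    (u g : EuclideanSpace ℝ (Fin d) → H) : Prop :=
  LocallyIntegrableOn u Ω ∧ LocallyIntegrableOn g Ω ∧
    ∀ φ : EuclideanSpace ℝ (Fin d) → ℝ,
      ContDiff ℝ ∞ φ → HasCompactSupport φ → tsupport φ ⊆ Ω →
        -∫ x in Ω, (fderiv ℝ φ x (EuclideanSpace.single k 1)) • u x = ∫ x in Ω, φ x • g x

/-- `u` represents an element of the Sobolev space `H¹(Ω, H)`: it lies in `L₂(Ω, H)` and has weak
partial derivatives of first order, in every coordinate direction, in `L₂(Ω, H)`. -/
def MemH1 {d : ℕ} {H : Type*} [NormedAddCommGroup H] [NormedSpace ℝ H]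
    (Ω : Set (EuclideanSpace ℝ (Fin d))) (u : EuclideanSpace ℝ (Fin d) → H) : Prop :=
  MemLp u 2 (volume.restrict Ω) ∧
    ∀ k : Fin d, ∃ g : EuclideanSpace ℝ (Fin d) → H,
      MemLp g 2 (volume.restrict Ω) ∧ HasWeakPartialDeriv Ω k u g

open Classical in
/-- The vector-valued sign: `(sgn u)(x) = ‖u x‖⁻¹ u(x)` if `u x ≠ 0`, and `0` if `u x = 0`. -/
noncomputable def vecSgn {X H : Type*} [NormedAddCommGroup H] [NormedSpace ℝ H]
    (u : X → H) (x : X) : H :=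
  if u x = 0 then 0 else ‖u x‖⁻¹ • u x

/-- The truncation `(‖u‖_H^α ∧ M) u`. -/
noncomputable def normPowTrunc {X H : Type*} [NormedAddCommGroup H] [NormedSpace ℝ H]
    (α M : ℝ) (u : X → H) (x : X) : H :=
  (min (‖u x‖ ^ α) M) • u x

/-! The function `v` is `G ∘ u` with `G z = (‖z‖ ^ α ∧ M) z`. This `G` is Lipschitz and vanishes at
`0`, but it has a kink on the sphere `‖z‖ ^ α = M`. There it has only one-sided directional
derivatives, not linear in the direction.

These suffice for a chain rule. If `w` and its weak derivative `g` are in `L¹` of the whole space,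
the difference quotients of `w` converge to `g` in `L¹`. As `G` is Lipschitz, `G (w (x + t e))` may
then be replaced by `G (w x + t g x)` up to `o(t)` in `L¹`, and dominated convergence gives the weak
derivative `G' (w x) (g x)` (`HasGlobalWeakDeriv.comp_of_lipschitz`). A cutoff transfers this to
`Ω`.

The chain rule holds for right and for left derivatives. By uniqueness of weak derivatives the two
results agree almost everywhere, so the radial contribution vanishes almost everywhere on the kink
set. This yields the strict inequality in the indicator. -/

open Filter Topology Set

set_option linter.unusedSectionVars false

/-! ### Translations in `L¹` and difference quotients. -/

section Translation

variable {E H : Type*} [NormedAddCommGroup E] [NormedSpace ℝ E] [FiniteDimensional ℝ E]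
  [MeasurableSpace E] [BorelSpace E] {μ : Measure E} [μ.IsAddHaarMeasure]
  [NormedAddCommGroup H] [NormedSpace ℝ H]

/-- `g` is the weak derivative of `w` in direction `e` on the whole space. -/
def HasGlobalWeakDeriv (μ : Measure E) (e : E) (w g : E → H) : Prop :=
  ∀ φ : E → ℝ, ContDiff ℝ ∞ φ → HasCompactSupport φ →
    -∫ x, (fderiv ℝ φ x e) • w x ∂μ = ∫ x, φ x • g x ∂μ

theorem ContDiff.exists_norm_fderiv_apply_le {φ : E → ℝ} (hφ : ContDiff ℝ ∞ φ)
    (hc : HasCompactSupport φ) (e : E) : ∃ C : ℝ, ∀ x, ‖fderiv ℝ φ x e‖ ≤ C :=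
  (hc.fderiv_apply ℝ e).exists_bound_of_continuous
    ((hφ.continuous_fderiv (by simp)).clm_apply continuous_const)

theorem MeasureTheory.Integrable.bounded_smul {f : E → H} (hf : Integrable f μ) {φ : E → ℝ}
    (hφ : Continuous φ) {C : ℝ} (hC : ∀ x, ‖φ x‖ ≤ C) : Integrable (fun x => φ x • f x) μ :=
  hf.bdd_smul C hφ.aestronglyMeasurable (.of_forall hC)

theorem integral_smul_comp_add (φ : E → ℝ) (f : E → H) (a : E) :
    ∫ x, φ x • f (x + a) ∂μ = ∫ x, φ (x - a) • f x ∂μ := by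
  rw [← integral_add_right_eq_self (μ := μ) (fun x => φ (x - a) • f x) a]
  simp

theorem hasDerivAt_integral_translate {φ : E → ℝ} (hφ : ContDiff ℝ ∞ φ)
    (hc : HasCompactSupport φ) {f : E → H} (hf : Integrable f μ) (e : E) (t : ℝ) :
    HasDerivAt (fun s : ℝ => ∫ x, φ (x - s • e) • f x ∂μ)
      (-∫ x, fderiv ℝ φ (x - t • e) e • f x ∂μ) t := by
  obtain ⟨C, hC⟩ := hφ.exists_norm_fderiv_apply_le hc e
  obtain ⟨D, hD⟩ := hc.exists_bound_of_continuous hφ.continuous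
  have hd : Continuous fun x => fderiv ℝ φ x e :=
    (hφ.continuous_fderiv (by simp)).clm_apply continuous_const
  have hφ' : ∀ s : ℝ, Integrable (fun x => φ (x - s • e) • f x) μ := fun s =>
    hf.bounded_smul (hφ.continuous.comp (by fun_prop)) fun x => hD _
  have hdi : ∀ s : ℝ, Integrable (fun x => fderiv ℝ φ (x - s • e) e • f x) μ := fun s =>
    hf.bounded_smul (hd.comp (continuous_id.sub continuous_const)) fun x => hC _
  have key := (hasDerivAt_integral_of_dominated_loc_of_deriv_le (μ := μ) (s := univ)
    (F := fun s x => φ (x - s • e) • f x) (x₀ := t)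
    (F' := fun s x => (-fderiv ℝ φ (x - s • e) e) • f x) (bound := fun x => C * ‖f x‖)
    univ_mem (.of_forall fun s => (hφ' s).aestronglyMeasurable) (hφ' t)
    (by simpa [Pi.neg_def] using (hdi t).neg.aestronglyMeasurable)
    (.of_forall fun x s _ => by
      rw [norm_smul, norm_neg]
      exact mul_le_mul_of_nonneg_right (hC _) (norm_nonneg _))
    (hf.norm.const_mul C)
    (.of_forall fun x s _ => by
      have h1 : HasDerivAt (fun s : ℝ => x - s • e) (-e) s := by
        simpa using ((hasDerivAt_id s).smul_const e).const_sub x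
      have h2 := ((hφ.differentiable (by simp)) (x - s • e)).hasFDerivAt.comp_hasDerivAt s h1
      simpa using h2.smul_const (f x))).2
  simpa [integral_neg] using key

/-- Translation by `a` on `L¹`. -/
noncomputable def translateL1 (μ : Measure E) [μ.IsAddHaarMeasure] (a : E) (f : Lp H 1 μ) :
    Lp H 1 μ :=
  Lp.compMeasurePreserving (fun x => x + a) (measurePreserving_add_right μ a) f

theorem coeFn_translateL1 (a : E) (f : Lp H 1 μ) :
    translateL1 μ a f =ᵐ[μ] fun x => f (x + a) :=
  Lp.coeFn_compMeasurePreserving f (measurePreserving_add_right μ a)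

theorem translateL1_zero (f : Lp H 1 μ) : translateL1 μ 0 f = f := by
  refine Lp.ext ((coeFn_translateL1 0 f).trans (.of_forall fun x => ?_))
  simp

theorem continuous_translateL1 (e : E) (f : Lp H 1 μ) :
    Continuous fun t : ℝ => translateL1 μ (t • e) f := by
  let T : ℝ → C(E, E) := fun t => ⟨fun x => x + t • e, by fun_prop⟩
  have hT : Continuous T := ContinuousMap.continuous_of_continuous_uncurry _ (by
    change Continuous fun p : ℝ × E => p.2 + p.1 • e
    fun_prop)
  exact Continuous.compMeasurePreservingLp (p := 1) (f := fun _ : ℝ => f) continuous_const hT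
    (fun t => measurePreserving_add_right μ (t • e)) ENNReal.one_ne_top

/-- Integration on `L¹` against a bounded continuous weight. -/
noncomputable def integralAgainst (μ : Measure E) [μ.IsAddHaarMeasure] (φ : E → ℝ)
    (hφ : Continuous φ) (C : ℝ)
    (hC : ∀ x, ‖φ x‖ ≤ C) : Lp H 1 μ →L[ℝ] H :=
  LinearMap.mkContinuous
    { toFun := fun f => ∫ x, φ x • f x ∂μ
      map_add' := fun f g => by
        rw [← integral_add ((L1.integrable_coeFn f).bounded_smul hφ hC)
          ((L1.integrable_coeFn g).bounded_smul hφ hC)]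
        refine integral_congr_ae ?_
        filter_upwards [Lp.coeFn_add f g] with x hx
        rw [hx, Pi.add_apply, smul_add]
      map_smul' := fun c f => by
        rw [RingHom.id_apply, ← integral_smul]
        refine integral_congr_ae ?_
        filter_upwards [Lp.coeFn_smul c f] with x hx
        simp [hx, smul_comm c] }
    C fun f => by
      rw [L1.norm_eq_integral_norm, ← integral_const_mul]
      refine norm_integral_le_of_norm_le ((L1.integrable_coeFn f).norm.const_mul C)
        (.of_forall fun x => ?_)
      rw [norm_smul]
      exact mul_le_mul_of_nonneg_right (hC x) (norm_nonneg _)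

/-- Fundamental theorem of calculus along the translation group. Tested against `φ`, the translation
moves onto `φ`, and the weak derivative identity for the shifted test function gives a classical
derivative in `s`. Continuity of the test functional lets it pass through the Bochner integral. -/
theorem translateL1_sub_eq_integral [CompleteSpace H] {e : E} {w g : Lp H 1 μ}
    (h : HasGlobalWeakDeriv μ e w g) (t : ℝ) :
    translateL1 μ (t • e) w - w = ∫ s in (0 : ℝ)..t, translateL1 μ (s • e) g := by
  have hint : ∀ a b : ℝ, IntervalIntegrable (fun s : ℝ => translateL1 μ (s • e) g) volume a b :=
    fun a b => (continuous_translateL1 e g).intervalIntegrable a b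
  refine Lp.ext (ae_eq_of_integral_contDiff_smul_eq (L1.integrable_coeFn _).locallyIntegrable
    (L1.integrable_coeFn _).locallyIntegrable fun φ hφ hc => ?_)
  obtain ⟨C, hC⟩ := hc.exists_bound_of_continuous hφ.continuous
  set ℓ : Lp H 1 μ →L[ℝ] H := integralAgainst μ φ hφ.continuous C hC with hℓ
  have htr : ∀ (f : Lp H 1 μ) (s : ℝ),
      ℓ (translateL1 μ (s • e) f) = ∫ x, φ (x - s • e) • f x ∂μ := fun f s => by
    rw [← integral_smul_comp_add]
    refine integral_congr_ae ?_
    filter_upwards [coeFn_translateL1 (s • e) f] with x hx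
    rw [hx]
  change ℓ (translateL1 μ (t • e) w - w) = ℓ (∫ s in (0 : ℝ)..t, translateL1 μ (s • e) g)
  rw [← ℓ.intervalIntegral_comp_comm (hint 0 t), map_sub]
  have hder : ∀ s : ℝ, HasDerivAt (fun s : ℝ => ℓ (translateL1 μ (s • e) w))
      (ℓ (translateL1 μ (s • e) g)) s := fun s => by
    simp_rw [htr]
    have h1 := hasDerivAt_integral_translate (μ := μ) hφ hc (L1.integrable_coeFn w) e s
    have h2 := h (fun x => φ (x - s • e)) (hφ.comp (contDiff_id.sub contDiff_const))
      (hc.comp_homeomorph (Homeomorph.subRight (s • e)))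
    simp only [fderiv_comp_sub] at h2
    rwa [h2] at h1
  rw [intervalIntegral.integral_eq_sub_of_hasDerivAt (fun s _ => hder s)
    ((ℓ.continuous.comp (continuous_translateL1 e g)).intervalIntegrable 0 t)]
  simp [translateL1_zero]

theorem hasDerivAt_translateL1 [CompleteSpace H] {e : E} {w g : Lp H 1 μ}
    (h : HasGlobalWeakDeriv μ e w g) :
    HasDerivAt (fun t : ℝ => translateL1 μ (t • e) w) g 0 := by
  have h1 := intervalIntegral.integral_hasDerivAt_right
    ((continuous_translateL1 e g).intervalIntegrable 0 0)
    (continuous_translateL1 e g).stronglyMeasurable.stronglyMeasurableAtFilter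
    (continuous_translateL1 e g).continuousAt
  simp only [← translateL1_sub_eq_integral h, zero_smul, translateL1_zero] at h1
  simpa using h1.add_const w

theorem HasGlobalWeakDeriv.congr_ae {e : E} {w w' g g' : E → H}
    (h : HasGlobalWeakDeriv μ e w g) (hw : w =ᵐ[μ] w') (hg : g =ᵐ[μ] g') :
    HasGlobalWeakDeriv μ e w' g' := fun φ hφ hc => by
  rw [← integral_congr_ae (hg.mono fun x hx => congrArg (φ x • ·) hx), ← h φ hφ hc,
    integral_congr_ae (hw.mono fun x hx => congrArg (fderiv ℝ φ x e • ·) hx)]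

/-- Difference quotients converge in `L¹` to the weak derivative. -/
theorem HasGlobalWeakDeriv.tendsto_integral_norm_slope_sub [CompleteSpace H] {e : E} {w g : E → H}
    (h : HasGlobalWeakDeriv μ e w g) (hw : Integrable w μ) (hg : Integrable g μ) :
    Tendsto (fun t : ℝ => ∫ x, ‖t⁻¹ • (w (x + t • e) - w x) - g x‖ ∂μ) (𝓝[≠] 0) (𝓝 0) := by
  have h' : HasGlobalWeakDeriv μ e (hw.toL1 w) (hg.toL1 g) :=
    h.congr_ae hw.coeFn_toL1.symm hg.coeFn_toL1.symm
  have hs := (hasDerivAt_translateL1 h').tendsto_slope_zero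
  rw [tendsto_iff_norm_sub_tendsto_zero] at hs
  refine hs.congr fun t => ?_
  rw [L1.norm_eq_integral_norm]
  refine integral_congr_ae ?_
  have hadd : ∀ᵐ x ∂μ, hw.toL1 w (x + t • e) = w (x + t • e) :=
    (measurePreserving_add_right μ (t • e)).quasiMeasurePreserving.ae hw.coeFn_toL1
  simp only [zero_add, zero_smul, translateL1_zero]
  filter_upwards [Lp.coeFn_sub (t⁻¹ • (translateL1 μ (t • e) (hw.toL1 w) - hw.toL1 w)) (hg.toL1 g),
    Lp.coeFn_smul t⁻¹ (translateL1 μ (t • e) (hw.toL1 w) - hw.toL1 w),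
    Lp.coeFn_sub (translateL1 μ (t • e) (hw.toL1 w)) (hw.toL1 w),
    coeFn_translateL1 (t • e) (hw.toL1 w), hw.coeFn_toL1, hg.coeFn_toL1, hadd]
    with x h1 h2 h3 h4 h5 h6 h7
  simp only [Pi.sub_apply, Pi.smul_apply] at h1 h2 h3
  rw [h1, h2, h3, h4, h5, h6, h7]

end Translation

/-! ### Chain rule on the whole space. -/

section ChainRule

variable {E H F : Type*} [NormedAddCommGroup E] [NormedSpace ℝ E] [FiniteDimensional ℝ E]
  [MeasurableSpace E] [BorelSpace E] {μ : Measure E} [μ.IsAddHaarMeasure]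
  [NormedAddCommGroup H] [NormedSpace ℝ H] [NormedAddCommGroup F] [NormedSpace ℝ F]

/-- `G' z v` is the derivative of `G` at `z` in direction `v`, as a limit of difference quotients
along the filter `l` (which may be one-sided). -/
def HasDirDerivAlong (l : Filter ℝ) (G : H → F) (G' : H → H → F) : Prop :=
  ∀ z v, Tendsto (fun t : ℝ => t⁻¹ • (G (z + t • v) - G z)) l (𝓝 (G' z v))

theorem LipschitzWith.norm_slope_le {K : NNReal} {G : H → F} (hG : LipschitzWith K G) {t : ℝ}
    (ht : t ≠ 0) (z v : H) : ‖t⁻¹ • (G (z + t • v) - G z)‖ ≤ K * ‖v‖ := by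
  have h := hG.norm_sub_le (z + t • v) z
  rw [add_sub_cancel_left, norm_smul] at h
  rw [norm_smul, norm_inv, inv_mul_le_iff₀ (norm_pos_iff.2 ht)]
  linarith

theorem HasDirDerivAlong.norm_le {l : Filter ℝ} [l.NeBot] (hl : l ≤ 𝓝[≠] 0) {K : NNReal}
    {G : H → F} {G' : H → H → F} (hG : LipschitzWith K G) (hG' : HasDirDerivAlong l G G')
    (z v : H) : ‖G' z v‖ ≤ K * ‖v‖ :=
  le_of_tendsto (hG' z v).norm
    (mem_of_superset (hl self_mem_nhdsWithin) fun _ ht => hG.norm_slope_le ht z v)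

/-- No regularity of `G'` is assumed; measurability is inherited from the difference quotients
because `l` is countably generated. -/
theorem HasDirDerivAlong.aestronglyMeasurable {X : Type*} [MeasurableSpace X] {ν : Measure X}
    {l : Filter ℝ} [l.NeBot] [l.IsCountablyGenerated]
    {G : H → F} {G' : H → H → F} (hG : Continuous G) (hG' : HasDirDerivAlong l G G')
    {w g : X → H} (hw : AEStronglyMeasurable w ν) (hg : AEStronglyMeasurable g ν) :
    AEStronglyMeasurable (fun x => G' (w x) (g x)) ν :=
  aestronglyMeasurable_of_tendsto_ae l
    (fun t => ((hG.comp_aestronglyMeasurable (hw.add (hg.const_smul t))).sub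
      (hG.comp_aestronglyMeasurable hw)).const_smul t⁻¹)
    (.of_forall fun x => hG' (w x) (g x))

/-- Chain rule for weak derivatives on the whole space and Lipschitz, one-sidedly directionally
differentiable outer functions. -/
theorem HasGlobalWeakDeriv.comp_of_lipschitz [CompleteSpace H] {e : E} {w g : E → H}
    (h : HasGlobalWeakDeriv μ e w g) (hw : Integrable w μ) (hg : Integrable g μ)
    {l : Filter ℝ} [l.NeBot] [l.IsCountablyGenerated] (hl : l ≤ 𝓝[≠] 0) {K : NNReal}
    {G : H → F} {G' : H → H → F} (hG : LipschitzWith K G) (hG0 : G 0 = 0)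
    (hG' : HasDirDerivAlong l G G') :
    HasGlobalWeakDeriv μ e (G ∘ w) (fun x => G' (w x) (g x)) := fun φ hφ hc => by
  obtain ⟨C, hC⟩ := hc.exists_bound_of_continuous hφ.continuous
  have hC0 : 0 ≤ C := (norm_nonneg _).trans (hC 0)
  have hv : Integrable (G ∘ w) μ :=
    memLp_one_iff_integrable.1 (hG.comp_memLp hG0 (memLp_one_iff_integrable.2 hw))
  have hvt : ∀ t : ℝ, Integrable (fun x => (G ∘ w) (x + t • e)) μ := fun t =>
    hv.comp_add_right (t • e)
  have hwg : ∀ t : ℝ, Integrable (fun x => G (w x + t • g x)) μ := fun t =>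
    memLp_one_iff_integrable.1
      (hG.comp_memLp hG0 (memLp_one_iff_integrable.2 (hw.add (hg.smul t))))
  have hne : ∀ᶠ t in l, t ≠ 0 := hl self_mem_nhdsWithin
  have hA' : ∀ t : ℝ, Integrable (fun x => φ x • (t⁻¹ • (G (w (x + t • e)) - G (w x)))) μ :=
    fun t => (((hvt t).sub hv).smul t⁻¹).bounded_smul hφ.continuous hC
  have hB' : ∀ t : ℝ, Integrable (fun x => φ x • (t⁻¹ • (G (w x + t • g x) - G (w x)))) μ :=
    fun t => (((hwg t).sub hv).smul t⁻¹).bounded_smul hφ.continuous hC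
  -- Discrete integration by parts: the shift moves onto the smooth `φ`, so no differentiability of
  -- `G ∘ w` is needed.
  have hA : Tendsto (fun t : ℝ => ∫ x, φ x • (t⁻¹ • (G (w (x + t • e)) - G (w x))) ∂μ) l
      (𝓝 (-∫ x, fderiv ℝ φ x e • (G ∘ w) x ∂μ)) := by
    have h1 := (hasDerivAt_integral_translate hφ hc hv e 0).tendsto_slope_zero.mono_left hl
    simp only [zero_add, zero_smul, sub_zero] at h1
    refine h1.congr fun t => ?_
    rw [← integral_smul_comp_add, ← integral_sub ((hvt t).bounded_smul hφ.continuous hC)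
      (hv.bounded_smul hφ.continuous hC), ← integral_smul]
    refine integral_congr_ae (.of_forall fun x => ?_)
    simp only [Function.comp_apply]
    rw [← smul_sub, smul_comm]
  have hB : Tendsto (fun t : ℝ => ∫ x, φ x • (t⁻¹ • (G (w x + t • g x) - G (w x))) ∂μ) l
      (𝓝 (∫ x, φ x • G' (w x) (g x) ∂μ)) := by
    refine tendsto_integral_filter_of_dominated_convergence (fun x => C * (K * ‖g x‖))
      (.of_forall fun t => (hB' t).aestronglyMeasurable)
      (hne.mono fun t ht => .of_forall fun x => ?_) ((hg.norm.const_mul _).const_mul _)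
      (.of_forall fun x => (hG' (w x) (g x)).const_smul (φ x))
    rw [norm_smul]
    exact mul_le_mul (hC x) (hG.norm_slope_le ht _ _) (norm_nonneg _) hC0
  have hD := ((h.tendsto_integral_norm_slope_sub hw hg).mono_left hl).const_mul (C * K)
  rw [mul_zero] at hD
  -- The integrands differ by at most `C * K` times the error of the difference quotient of `w`
  -- against `g`, which tends to zero in `L¹`.
  have hAB := squeeze_zero_norm' (f := fun t : ℝ =>
      (∫ x, φ x • (t⁻¹ • (G (w (x + t • e)) - G (w x))) ∂μ) -
        ∫ x, φ x • (t⁻¹ • (G (w x + t • g x) - G (w x))) ∂μ) (hne.mono fun t ht => ?_) hD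
  · have h0 := hA.sub hB
    exact sub_eq_zero.1 (tendsto_nhds_unique h0 hAB)
  · rw [← integral_sub (hA' t) (hB' t), ← integral_const_mul]
    refine norm_integral_le_of_norm_le
      ((((((hw.comp_add_right (t • e)).sub hw).smul t⁻¹).sub hg).norm).const_mul _)
      (.of_forall fun x => ?_)
    rw [← smul_sub, norm_smul, mul_assoc]
    refine mul_le_mul (hC x) ?_ (norm_nonneg _) hC0
    have h1 := hG.norm_sub_le (w (x + t • e)) (w x + t • g x)
    have h2 : t⁻¹ • (w (x + t • e) - w x) - g x = t⁻¹ • (w (x + t • e) - (w x + t • g x)) := by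
      rw [smul_sub, smul_sub, smul_add, inv_smul_smul₀ ht]
      abel
    rw [← smul_sub, sub_sub_sub_cancel_right, norm_smul]
    rw [h2, norm_smul, mul_left_comm]
    exact mul_le_mul_of_nonneg_left h1 (norm_nonneg _)

end ChainRule

/-! ### Smooth cutoffs and local integrability. -/

section Localization

variable {E : Type*} [NormedAddCommGroup E] [NormedSpace ℝ E] [FiniteDimensional ℝ E]

theorem IsCompact.exists_contDiff_cutoff {K U : Set E} (hK : IsCompact K) (hU : IsOpen U)
    (hKU : K ⊆ U) : ∃ χ : E → ℝ, ContDiff ℝ ∞ χ ∧ HasCompactSupport χ ∧ tsupport χ ⊆ U ∧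
      ∀ x ∈ K, χ x = 1 := by
  obtain ⟨L, hL, hKL, hLU⟩ := exists_compact_between hK hU hKU
  obtain ⟨χ, hχ, -, hs, h1⟩ := exists_contMDiff_support_eq_eq_one_iff 
    (modelWithCornersSelf ℝ E) isOpen_interior hK.isClosed hKL
  have hsub : tsupport χ ⊆ L := by
    rw [tsupport, hs]
    exact closure_minimal interior_subset hL.isClosed
  exact ⟨χ, hχ.contDiff, hL.of_isClosed_subset (isClosed_tsupport χ) hsub, hsub.trans hLU,
    fun x hx => (h1 x).1 hx⟩

variable [MeasurableSpace E] [BorelSpace E] {μ : Measure E}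
  {H : Type*} [NormedAddCommGroup H] [NormedSpace ℝ H]

theorem MeasureTheory.LocallyIntegrableOn.integrable_smul_of_tsupport_subset {U : Set E}
    {f : E → H} (hf : LocallyIntegrableOn f U μ) {χ : E → ℝ} (hχ : Continuous χ)
    (hc : HasCompactSupport χ) (hU : tsupport χ ⊆ U) : Integrable (fun x => χ x • f x) μ := by
  obtain ⟨C, hC⟩ := hc.exists_bound_of_continuous hχ
  refine (integrableOn_iff_integrable_of_support_subset (s := tsupport χ) fun x hx => ?_).1
    ((hf.integrableOn_compact_subset hU hc).bdd_smul C hχ.aestronglyMeasurable (.of_forall hC))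
  refine subset_tsupport χ fun h0 => hx ?_
  simp [h0]

theorem MeasureTheory.LocallyIntegrableOn.of_norm_le_mul {F : Type*} [NormedAddCommGroup F]
    {U : Set E} (hU : IsOpen U) {f : E → H} (hf : LocallyIntegrableOn f U μ) {g : E → F}
    (hg : AEStronglyMeasurable g (μ.restrict U)) {C : ℝ} (h : ∀ x, ‖g x‖ ≤ C * ‖f x‖) :
    LocallyIntegrableOn g U μ := by
  rw [locallyIntegrableOn_iff hU.isLocallyClosed] at hf ⊢
  exact fun K hKU hK => ((hf K hKU hK).norm.const_mul C).mono'
    (hg.mono_measure (Measure.restrict_mono hKU le_rfl)) (.of_forall h)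

end Localization

/-! ### Weak derivatives on an open set: chain rule and uniqueness. -/

section WeakPartialDeriv

variable {d : ℕ} {H F : Type*} [NormedAddCommGroup H] [NormedSpace ℝ H]
  [NormedAddCommGroup F] [NormedSpace ℝ F]
  {Ω : Set (EuclideanSpace ℝ (Fin d))} {k : Fin d} {u g : EuclideanSpace ℝ (Fin d) → H}

/-- Product rule, from testing with `φ * χ`, which is supported in `Ω` for every global test
function `φ`. -/
theorem HasWeakPartialDeriv.hasGlobalWeakDeriv_cutoff (h : HasWeakPartialDeriv Ω k u g)
    {χ : EuclideanSpace ℝ (Fin d) → ℝ} (hχ : ContDiff ℝ ∞ χ) (hc : HasCompactSupport χ)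
    (hs : tsupport χ ⊆ Ω) :
    HasGlobalWeakDeriv volume (EuclideanSpace.single k (1 : ℝ)) (fun x => χ x • u x)
      (fun x => χ x • g x + fderiv ℝ χ x (EuclideanSpace.single k 1) • u x) := fun φ hφ hφc => by
  set e : EuclideanSpace ℝ (Fin d) := EuclideanSpace.single k 1
  have hdχ : Continuous fun x => fderiv ℝ χ x e :=
    (hχ.continuous_fderiv (by simp)).clm_apply continuous_const
  have hdφ : Continuous fun x => fderiv ℝ φ x e :=
    (hφ.continuous_fderiv (by simp)).clm_apply continuous_const
  have hχ0 : ∀ x ∉ Ω, χ x = 0 := fun x hx => image_eq_zero_of_notMem_tsupport fun h' => hx (hs h')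
  have hdχ0 : ∀ x ∉ Ω, fderiv ℝ χ x e = 0 := fun x hx => by
    rw [fderiv_of_notMem_tsupport (𝕜 := ℝ) fun h' => hx (hs h')]
    rfl
  have hsd : tsupport (fun x => fderiv ℝ χ x e) ⊆ Ω := (tsupport_fderiv_apply_subset ℝ e).trans hs
  have hcu := h.1.integrable_smul_of_tsupport_subset hχ.continuous hc hs
  have hcg := h.2.1.integrable_smul_of_tsupport_subset hχ.continuous hc hs
  have hdu := h.1.integrable_smul_of_tsupport_subset hdχ (hc.fderiv_apply ℝ e) hsd
  obtain ⟨C, hC⟩ := hφc.exists_bound_of_continuous hφ.continuous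
  obtain ⟨D, hD⟩ := hφ.exists_norm_fderiv_apply_le hφc e
  have hprod : ∀ x, fderiv ℝ (fun y => φ y * χ y) x e =
      φ x * fderiv ℝ χ x e + χ x * fderiv ℝ φ x e := fun x => by
    rw [fderiv_fun_mul (hφ.differentiable (by simp) x) (hχ.differentiable (by simp) x)]
    simp
  have key := h.2.2 (fun y => φ y * χ y) (hφ.mul hχ) hc.mul_left
    ((tsupport_mul_subset_right (f := φ) (g := χ)).trans hs)
  rw [setIntegral_eq_integral_of_forall_compl_eq_zero (fun x hx => by
      rw [hprod, hχ0 x hx, hdχ0 x hx]; simp),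
    setIntegral_eq_integral_of_forall_compl_eq_zero (fun x hx => by simp [hχ0 x hx])] at key
  have e1 : ∫ x, fderiv ℝ (fun y => φ y * χ y) x e • u x =
      (∫ x, φ x • fderiv ℝ χ x e • u x) + ∫ x, fderiv ℝ φ x e • χ x • u x := by
    rw [← integral_add (hdu.bounded_smul hφ.continuous hC) (hcu.bounded_smul hdφ hD)]
    refine integral_congr_ae (.of_forall fun x => ?_)
    simp only [hprod, add_smul, mul_smul]
    rw [smul_comm (χ x)]
  have e2 : ∫ x, φ x • (χ x • g x + fderiv ℝ χ x e • u x) =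
      (∫ x, (φ x * χ x) • g x) + ∫ x, φ x • fderiv ℝ χ x e • u x := by
    simp only [mul_smul]
    rw [← integral_add (hcg.bounded_smul hφ.continuous hC) (hdu.bounded_smul hφ.continuous hC)]
    simp only [smul_add]
  rw [e2, ← key, e1]
  abel

/-- Chain rule for weak partial derivatives and Lipschitz, one-sidedly directionally
differentiable outer functions. -/
theorem HasWeakPartialDeriv.comp_of_lipschitz [CompleteSpace H] (hΩ : IsOpen Ω)
    (h : HasWeakPartialDeriv Ω k u g)
    {l : Filter ℝ} [l.NeBot] [l.IsCountablyGenerated] (hl : l ≤ 𝓝[≠] 0) {K : NNReal}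
    {G : H → F} {G' : H → H → F} (hG : LipschitzWith K G) (hG0 : G 0 = 0)
    (hG' : HasDirDerivAlong l G G') :
    HasWeakPartialDeriv Ω k (G ∘ u) (fun x => G' (u x) (g x)) := by
  have hum := h.1.aestronglyMeasurable
  have hgm := h.2.1.aestronglyMeasurable
  refine ⟨h.1.of_norm_le_mul hΩ (hG.continuous.comp_aestronglyMeasurable hum) (C := K) fun x => ?_,
    h.2.1.of_norm_le_mul hΩ (hG'.aestronglyMeasurable hG.continuous hum hgm) (C := K)
      fun x => hG'.norm_le hl hG _ _, fun φ hφ hc hs => ?_⟩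
  · simpa [hG0] using hG.norm_sub_le (u x) 0
  set e : EuclideanSpace ℝ (Fin d) := EuclideanSpace.single k 1 with he
  -- With `χ = 1` on the support of `φ`, replacing `u` by `χ u` inside `G` changes nothing that `φ`
  -- sees.
  obtain ⟨χ, hχ, hχc, hχs, hχ1⟩ := hc.isCompact.exists_contDiff_cutoff hΩ hs
  have hdχ : Continuous fun x => fderiv ℝ χ x e :=
    (hχ.continuous_fderiv (by simp)).clm_apply continuous_const
  have hw := h.1.integrable_smul_of_tsupport_subset hχ.continuous hχc hχs
  have hgw := (h.2.1.integrable_smul_of_tsupport_subset hχ.continuous hχc hχs).add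
    (h.1.integrable_smul_of_tsupport_subset hdχ (hχc.fderiv_apply ℝ e)
      ((tsupport_fderiv_apply_subset ℝ e).trans hχs))
  have key := (h.hasGlobalWeakDeriv_cutoff hχ hχc hχs).comp_of_lipschitz hw hgw hl hG hG0 hG' φ hφ hc
  have hφ0 : ∀ x ∉ Ω, φ x = 0 := fun x hx => image_eq_zero_of_notMem_tsupport fun h' => hx (hs h')
  have hdφ0 : ∀ x ∉ tsupport φ, fderiv ℝ φ x e = 0 := fun x hx => by
    rw [fderiv_of_notMem_tsupport (𝕜 := ℝ) hx]
    rfl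
  rw [setIntegral_eq_integral_of_forall_compl_eq_zero (fun x hx => by
      rw [hdφ0 x fun h' => hx (hs h'), zero_smul]),
    setIntegral_eq_integral_of_forall_compl_eq_zero (fun x hx => by rw [hφ0 x hx, zero_smul])]
  refine (congrArg Neg.neg (integral_congr_ae (.of_forall fun x => ?_))).trans
    (key.trans (integral_congr_ae (.of_forall fun x => ?_)))
  · by_cases hx : x ∈ tsupport φ
    · simp [hχ1 x hx, he]
    · simp [← he, hdφ0 x hx]
  · by_cases hx : φ x = 0
    · simp [hx]
    -- The set `φ ≠ 0` is open, so `χ` is constant near `x` and its derivative term drops out.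
    · have hx1 : χ =ᶠ[𝓝 x] fun _ => 1 :=
        mem_of_superset (hφ.continuous.isOpen_support.mem_nhds hx)
          fun y hy => hχ1 y (subset_tsupport φ hy)
      have hx2 : fderiv ℝ χ x = 0 := by rw [hx1.fderiv_eq]; simp
      simp [hx1.eq_of_nhds, hx2]

theorem HasWeakPartialDeriv.ae_eq [CompleteSpace H] (hΩ : IsOpen Ω) {g' : EuclideanSpace ℝ (Fin d) → H}
    (h : HasWeakPartialDeriv Ω k u g) (h' : HasWeakPartialDeriv Ω k u g') :
    g =ᵐ[volume.restrict Ω] g' := by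
  have key := hΩ.ae_eq_zero_of_integral_contDiff_smul_eq_zero (h.2.1.sub h'.2.1)
    fun φ hφ hc hs => ?_
  · refine (ae_restrict_iff' hΩ.measurableSet).2 (key.mono fun x hx hxΩ => ?_)
    simpa [sub_eq_zero] using hx hxΩ
  · have h1 := (h.2.2 φ hφ hc hs).symm.trans (h'.2.2 φ hφ hc hs)
    have hφ0 : ∀ x ∉ Ω, φ x = 0 := fun x hx =>
      image_eq_zero_of_notMem_tsupport fun h' => hx (hs h')
    rw [setIntegral_eq_integral_of_forall_compl_eq_zero (fun x hx => by rw [hφ0 x hx, zero_smul]),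
      setIntegral_eq_integral_of_forall_compl_eq_zero (fun x hx => by rw [hφ0 x hx, zero_smul])]
      at h1
    simp only [Pi.sub_apply, smul_sub]
    rw [integral_sub (h.2.1.integrable_smul_of_tsupport_subset hφ.continuous hc hs)
      (h'.2.1.integrable_smul_of_tsupport_subset hφ.continuous hc hs), h1, sub_self]

theorem HasWeakPartialDeriv.congr_ae (hΩ : IsOpen Ω) {g' : EuclideanSpace ℝ (Fin d) → H}
    (h : HasWeakPartialDeriv Ω k u g) (hg : g =ᵐ[volume.restrict Ω] g') :
    HasWeakPartialDeriv Ω k u g' := by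
  refine ⟨h.1, ?_, fun φ hφ hc hs => ?_⟩
  · have h2 := h.2.1
    rw [locallyIntegrableOn_iff hΩ.isLocallyClosed] at h2 ⊢
    exact fun K hKU hK => (h2 K hKU hK).congr (ae_restrict_of_ae_restrict_of_subset hKU hg)
  · rw [h.2.2 φ hφ hc hs]
    exact integral_congr_ae (hg.mono fun x hx => congrArg (φ x • ·) hx)

end WeakPartialDeriv

/-! ### Real inequalities and one-sided derivatives. -/

/-- The factor `r` compensates for the failure of `s ^ α` to be Lipschitz at `0` when `α < 1`.
Bernoulli's inequality for the exponent `α + 1` at `r / s` bounds `s ^ (α + 1) - r ^ (α + 1)`, which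
dominates the left side since `r ≤ s`. -/
theorem Real.rpow_sub_rpow_mul_le {α r s : ℝ} (hα : 0 ≤ α) (hr : 0 ≤ r) (hrs : r ≤ s) :
    (s ^ α - r ^ α) * r ≤ (α + 1) * s ^ α * (s - r) := by
  rcases hr.eq_or_lt with rfl | hr0
  · rw [mul_zero]
    have := Real.rpow_nonneg hrs α
    have : 0 ≤ s - 0 := by linarith
    positivity
  have hs : 0 < s := hr0.trans_le hrs
  have hsα : 0 < s ^ α := Real.rpow_pos_of_pos hs α
  have hb := one_add_mul_self_le_rpow_one_add (s := r / s - 1) (p := α + 1)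
    (by have := div_nonneg hr hs.le; linarith) (by linarith)
  rw [add_sub_cancel, Real.div_rpow hr hs.le, Real.rpow_add_one hr0.ne', Real.rpow_add_one hs.ne',
    le_div_iff₀ (by positivity)] at hb
  have h1 : (1 + (α + 1) * (r / s - 1)) * (s ^ α * s) =
      s ^ α * s + (α + 1) * (r - s) * s ^ α := by
    field_simp
  rw [h1] at hb
  nlinarith [mul_nonneg hsα.le (sub_nonneg.2 hrs)]

theorem Real.min_rpow_sub_min_rpow_mul_le {α M r s : ℝ} (hα : 0 < α) (hM : 0 < M) (hr : 0 ≤ r)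
    (hrs : r ≤ s) :
    (min (s ^ α) M - min (r ^ α) M) * r ≤ (α + 1) * M * (s - r) := by
  have hs := hr.trans hrs
  have hmono : r ^ α ≤ s ^ α := Real.rpow_le_rpow hr hrs hα.le
  have hsr : 0 ≤ s - r := sub_nonneg.2 hrs
  rcases le_or_gt M (r ^ α) with h | h
  · rw [min_eq_right h, min_eq_right (h.trans hmono), sub_self, zero_mul]
    positivity
  -- Truncation amounts to replacing `s` by `m ^ α⁻¹`, which lies between `r` and `s` and has `α`-th
  -- power `m ≤ M`.
  · set m := min (s ^ α) M with hm
    have hm0 : 0 ≤ m := le_min (Real.rpow_nonneg hs α) hM.le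
    have hS : (m ^ α⁻¹) ^ α = m := Real.rpow_inv_rpow hm0 hα.ne'
    have h1 : r ≤ m ^ α⁻¹ :=
      (Real.le_rpow_inv_iff_of_pos hr hm0 hα).2 (le_min hmono h.le)
    have h2 : m ^ α⁻¹ ≤ s := (Real.rpow_inv_le_iff_of_pos hm0 hs hα).2 (min_le_left _ _)
    have h3 := Real.rpow_sub_rpow_mul_le hα.le hr h1
    rw [hS] at h3
    rw [min_eq_left h.le]
    refine h3.trans ?_
    have hmM : m ≤ M := min_le_right _ _
    have : 0 ≤ m ^ α⁻¹ - r := sub_nonneg.2 h1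
    gcongr

/-- At the kink `f a = M`, the right slope of the minimum is the minimum of the slope of `f` and
`0`, because `t - a > 0`. -/
theorem HasDerivAt.min_const_Ioi {f : ℝ → ℝ} {p a : ℝ} (hf : HasDerivAt f p a) (M : ℝ) :
    HasDerivWithinAt (fun t => min (f t) M)
      (if f a < M then p else if f a = M then min p 0 else 0) (Ioi a) a := by
  rcases lt_trichotomy (f a) M with h | h | h
  · rw [if_pos h]
    have he : (fun t => min (f t) M) =ᶠ[𝓝 a] f := by
      filter_upwards [hf.continuousAt.eventually_lt continuousAt_const h] with t ht
      exact min_eq_left ht.le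
    exact (hf.congr_of_eventuallyEq he).hasDerivWithinAt
  · rw [if_neg h.not_lt, if_pos h, hasDerivWithinAt_iff_tendsto_slope' self_notMem_Ioi]
    have h1 := (hf.hasDerivWithinAt (s := Ioi a))
    rw [hasDerivWithinAt_iff_tendsto_slope' self_notMem_Ioi] at h1
    refine (h1.min tendsto_const_nhds).congr' ?_
    filter_upwards [self_mem_nhdsWithin] with t ht
    have ht' : 0 ≤ (t - a)⁻¹ := inv_nonneg.2 (sub_nonneg.2 (le_of_lt ht))
    rw [slope_def_module, slope_def_module, smul_eq_mul, smul_eq_mul, h, min_self,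
      ← min_sub_sub_right, sub_self, mul_min_of_nonneg _ _ ht', mul_zero]
  · rw [if_neg h.not_gt, if_neg h.ne']
    have he : (fun t => min (f t) M) =ᶠ[𝓝 a] fun _ => M := by
      filter_upwards [continuousAt_const.eventually_lt hf.continuousAt h] with t ht
      exact min_eq_right ht.le
    exact ((hasDerivAt_const a M).congr_of_eventuallyEq he).hasDerivWithinAt

/-- Substitute `-t` for `t` and `-v` for `v`; the two signs do not cancel unless `G' z` is odd,
which fails at a kink. -/
theorem HasDirDerivAlong.left_of_right {H F : Type*} [NormedAddCommGroup H] [NormedSpace ℝ H]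
    [NormedAddCommGroup F] [NormedSpace ℝ F] {G : H → F} {G' : H → H → F}
    (h : HasDirDerivAlong (𝓝[>] 0) G G') :
    HasDirDerivAlong (𝓝[<] 0) G (fun z v => -G' z (-v)) := fun z v => by
  have hneg : Tendsto (fun t : ℝ => -t) (𝓝[<] 0) (𝓝[>] 0) := by
    simpa using tendsto_neg_nhdsLT (a := (0 : ℝ))
  refine ((h z (-v)).comp hneg).neg.congr fun t => ?_
  simp [inv_neg]

/-! ### Lipschitz continuity of the truncation. -/

section NormPowTrunc

variable {H : Type*} [NormedAddCommGroup H] [NormedSpace ℝ H]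

theorem normPowTrunc_id_zero (α M : ℝ) : normPowTrunc α M (id : H → H) 0 = 0 := by
  simp [normPowTrunc]

/-- For `‖a‖ ≤ ‖b‖`, changing the vector costs `M * ‖b - a‖` and changing the scalar factor,
weighted by the smaller norm, costs `(α + 1) * M * ‖b - a‖`. -/
theorem lipschitzWith_normPowTrunc_id {α M : ℝ} (hα : 0 < α) (hM : 0 < M) :
    LipschitzWith (Real.toNNReal ((α + 2) * M)) (normPowTrunc α M (id : H → H)) := by
  refine LipschitzWith.of_dist_le_mul fun a b => ?_
  rw [Real.coe_toNNReal _ (by positivity)]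
  wlog hab : ‖a‖ ≤ ‖b‖ generalizing a b
  · rw [dist_comm, dist_comm a]
    exact this b a (le_of_not_ge hab)
  rw [dist_comm, dist_comm a, dist_eq_norm, dist_eq_norm]
  simp only [normPowTrunc, id]
  have h1 : (min (‖b‖ ^ α) M) • b - (min (‖a‖ ^ α) M) • a =
      (min (‖b‖ ^ α) M) • (b - a) + (min (‖b‖ ^ α) M - min (‖a‖ ^ α) M) • a := by
    rw [smul_sub, sub_smul]
    abel
  have hb0 : 0 ≤ min (‖b‖ ^ α) M := le_min (by positivity) hM.le
  have hba : 0 ≤ min (‖b‖ ^ α) M - min (‖a‖ ^ α) M :=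
    sub_nonneg.2 (min_le_min_right M (Real.rpow_le_rpow (norm_nonneg a) hab hα.le))
  have h2 := Real.min_rpow_sub_min_rpow_mul_le hα hM (norm_nonneg a) hab
  have h3 : ‖b‖ - ‖a‖ ≤ ‖b - a‖ := norm_sub_norm_le b a
  calc _ ≤ min (‖b‖ ^ α) M * ‖b - a‖ + (min (‖b‖ ^ α) M - min (‖a‖ ^ α) M) * ‖a‖ := by
        rw [h1]
        refine (norm_add_le _ _).trans_eq ?_
        rw [norm_smul, norm_smul, Real.norm_of_nonneg hb0, Real.norm_of_nonneg hba]
    _ ≤ M * ‖b - a‖ + (α + 1) * M * ‖b - a‖ := by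
        refine add_le_add ?_ (h2.trans ?_)
        · gcongr
          exact min_le_right _ _
        · gcongr
    _ = (α + 2) * M * ‖b - a‖ := by ring

end NormPowTrunc

/-! ### Directional derivatives of the truncation in an inner product space. -/

section InnerProduct

variable (𝕜 : Type*) {H : Type*} [RCLike 𝕜] [NormedAddCommGroup H] [InnerProductSpace 𝕜 H]
  [NormedSpace ℝ H] [IsScalarTower ℝ 𝕜 H]

/-- The derivative of `‖·‖ ^ α` at `z` in direction `v` (zero at `z = 0`). -/
noncomputable def normPowDeriv (α : ℝ) (z v : H) : ℝ :=
  α * ‖z‖ ^ α * ((‖z‖ ^ 2)⁻¹ * RCLike.re (inner 𝕜 z v))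

theorem normPowDeriv_neg (α : ℝ) (z v : H) :
    normPowDeriv 𝕜 α z (-v) = -normPowDeriv 𝕜 α z v := by
  simp [normPowDeriv]

/-- Along the line the squared norm is a quadratic polynomial in `t`, positive at `0`; compose it
with the power `α / 2`. -/
theorem hasDerivAt_norm_rpow_line (α : ℝ) {z : H} (hz : z ≠ 0) (v : H) :
    HasDerivAt (fun t : ℝ => ‖z + t • v‖ ^ α) (normPowDeriv 𝕜 α z v) 0 := by
  have hz' : 0 < ‖z‖ := norm_pos_iff.2 hz
  have hsq : ∀ t : ℝ, ‖z + t • v‖ ^ 2 =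
      ‖z‖ ^ 2 + t * (2 * RCLike.re (inner 𝕜 z v)) + t ^ 2 * ‖v‖ ^ 2 := fun t => by
    rw [norm_add_sq (𝕜 := 𝕜), ← algebraMap_smul 𝕜 t v, inner_smul_right, norm_smul]
    simp only [RCLike.algebraMap_eq_ofReal, RCLike.re_ofReal_mul, RCLike.norm_ofReal, mul_pow,
      sq_abs]
    ring
  have h1 : HasDerivAt (fun t : ℝ => ‖z + t • v‖ ^ 2) (2 * RCLike.re (inner 𝕜 z v)) 0 := by
    simp_rw [hsq]
    have := (((hasDerivAt_id (0 : ℝ)).mul_const (2 * RCLike.re (inner 𝕜 z v))).const_add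
      (‖z‖ ^ 2)).add (((hasDerivAt_id (0 : ℝ)).pow 2).mul_const (‖v‖ ^ 2))
    simpa [Pi.add_def] using this
  have h2 := h1.rpow_const (p := α / 2) (Or.inl (by simpa using hz))
  have h3 : ∀ y : H, (‖y‖ ^ 2) ^ (α / 2) = ‖y‖ ^ α := fun y => by
    rw [← Real.rpow_natCast, ← Real.rpow_mul (norm_nonneg y)]
    congr 1
    push_cast
    ring
  simp only [h3, zero_smul, add_zero] at h2
  convert h2 using 1
  rw [Real.rpow_sub_one (by positivity), h3, normPowDeriv]
  field_simp

/-- The right directional derivative of `z ↦ (‖z‖ ^ α ∧ M) z`. -/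
noncomputable def normPowTruncRightDeriv (α M : ℝ) (z v : H) : H :=
  (if ‖z‖ ^ α < M then normPowDeriv 𝕜 α z v
    else if ‖z‖ ^ α = M then min (normPowDeriv 𝕜 α z v) 0 else 0) • z + (min (‖z‖ ^ α) M) • v

theorem hasDirDerivAlong_normPowTrunc {α : ℝ} (hα : 0 < α) (M : ℝ) :
    HasDirDerivAlong (𝓝[>] 0) (normPowTrunc α M (id : H → H))
      (normPowTruncRightDeriv 𝕜 α M) := fun z v => by
  by_cases hz : z = 0
  · subst hz
    -- At the origin the difference quotient is exactly this function, so its limit follows from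
    -- continuity, using `α > 0`.
    have hc : Continuous fun t : ℝ => (min (‖t • v‖ ^ α) M) • v :=
      (((continuous_id.smul continuous_const).norm.rpow_const fun _ => Or.inr hα.le).min
        continuous_const).smul continuous_const
    have h := (hc.tendsto 0).mono_left (nhdsWithin_le_nhds (s := Ioi 0))
    simp only [zero_smul] at h
    simp only [normPowTruncRightDeriv, smul_zero, zero_add]
    refine h.congr' ?_
    filter_upwards [self_mem_nhdsWithin] with t ht
    simp only [normPowTrunc, id, smul_zero, sub_zero]
    rw [smul_comm t⁻¹, inv_smul_smul₀ (ne_of_gt ht)]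
  · have h1 := (hasDerivAt_norm_rpow_line 𝕜 α hz v).min_const_Ioi M
    have h2 : HasDerivWithinAt (fun t : ℝ => z + t • v) v (Ioi 0) 0 := by
      simpa using (((hasDerivAt_id (0 : ℝ)).smul_const v).const_add z).hasDerivWithinAt
    have h3 := h1.smul h2
    rw [hasDerivWithinAt_iff_tendsto_slope' self_notMem_Ioi] at h3
    simp only [zero_smul, add_zero] at h3
    rw [add_comm] at h3
    refine h3.congr fun t => ?_
    simp [slope_def_module, normPowTrunc]

theorem normPowDeriv_smul_eq (α : ℝ) {X : Type*} (u : X → H) (x : X) (v : H) :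
    normPowDeriv 𝕜 α (u x) v • u x =
      (α * ‖u x‖ ^ α * RCLike.re (inner 𝕜 (vecSgn u x) v)) • vecSgn u x := by
  by_cases hz : u x = 0
  · simp [vecSgn, hz]
  · rw [vecSgn, if_neg hz, ← algebraMap_smul 𝕜 ‖u x‖⁻¹ (u x), inner_smul_left,
      algebraMap_smul, smul_smul]
    congr 1
    simp only [RCLike.algebraMap_eq_ofReal, RCLike.conj_ofReal, RCLike.re_ofReal_mul, normPowDeriv]
    ring

/-- Where the two one-sided derivatives of the truncation agree, they are given by the formula
with the indicator of `‖u‖ ^ α < M`. -/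
theorem normPowTruncRightDeriv_eq {α M : ℝ} (hα : 0 < α) (hM : 0 < M) {X : Type*} (u : X → H)
    (x : X) (v : H)
    (h : normPowTruncRightDeriv 𝕜 α M (u x) v = -normPowTruncRightDeriv 𝕜 α M (u x) (-v)) :
    normPowTruncRightDeriv 𝕜 α M (u x) v =
      (α * Set.indicator {y | ‖u y‖ ^ α < M} (fun _ => (1 : ℝ)) x * ‖u x‖ ^ α *
        RCLike.re (inner 𝕜 (vecSgn u x) v)) • vecSgn u x + (min (‖u x‖ ^ α) M) • v := by
  rcases lt_trichotomy (‖u x‖ ^ α) M with hlt | heq | hgt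
  · rw [normPowTruncRightDeriv, if_pos hlt, normPowDeriv_smul_eq, Set.indicator_of_mem (by exact hlt),
      mul_one]
  · have hu : u x ≠ 0 := fun h0 => by
      rw [h0, norm_zero, Real.zero_rpow hα.ne'] at heq
      exact hM.ne heq
    rw [Set.indicator_of_notMem (by simp [heq]), mul_zero, zero_mul, zero_mul, zero_smul]
    simp only [normPowTruncRightDeriv, heq, lt_irrefl, if_false, if_true, normPowDeriv_neg, smul_neg,
      neg_add, neg_neg, add_left_inj] at h ⊢
    rw [← neg_smul, ← sub_eq_zero, ← sub_smul, smul_eq_zero, or_iff_left hu] at h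
    -- With `p` the derivative of the norm power, `h` says `min p 0 = -min (-p) 0`, that is `min p 0
    -- = max p 0`, so both are zero.
    have hp : min (normPowDeriv 𝕜 α (u x) v) 0 = 0 := by
      rcases le_total (normPowDeriv 𝕜 α (u x) v) 0 with h' | h'
      · rw [min_eq_left h', min_eq_right (neg_nonneg.2 h')] at h
        rw [min_eq_left h']
        linarith
      · exact min_eq_right h'
    rw [hp, zero_smul]
  · rw [normPowTruncRightDeriv, if_neg hgt.not_gt, if_neg hgt.ne',
      Set.indicator_of_notMem (by simp [hgt.le])]
    simp

end InnerProduct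

/-! ### The theorem. -/

theorem propositionA1 {𝕜 H : Type*} [RCLike 𝕜] [NormedAddCommGroup H] [InnerProductSpace 𝕜 H]
    [NormedSpace ℝ H] [IsScalarTower ℝ 𝕜 H] [CompleteSpace H]
    (d : ℕ) (Ω : Set (EuclideanSpace ℝ (Fin d))) (hΩ : IsOpen Ω)
    (α M : ℝ) (hα : 0 < α) (hM : 0 < M)
    (u : EuclideanSpace ℝ (Fin d) → H) (hu : MemH1 Ω u) :
    MemH1 Ω (normPowTrunc α M u) ∧
      ∀ (k : Fin d) (du : EuclideanSpace ℝ (Fin d) → H), HasWeakPartialDeriv Ω k u du →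
        ∀ dv : EuclideanSpace ℝ (Fin d) → H,
          HasWeakPartialDeriv Ω k (normPowTrunc α M u) dv ↔
            dv =ᵐ[volume.restrict Ω] fun x =>
              (α * Set.indicator {y | ‖u y‖ ^ α < M} (fun _ => (1 : ℝ)) x * ‖u x‖ ^ α *
                  RCLike.re (inner 𝕜 (vecSgn u x) (du x))) • vecSgn u x +
                (min (‖u x‖ ^ α) M) • du x := by
  have hG := lipschitzWith_normPowTrunc_id (H := H) hα hM
  have hG0 := normPowTrunc_id_zero (H := H) α M
  have hR := hasDirDerivAlong_normPowTrunc (H := H) 𝕜 hα M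
  have hgt : 𝓝[>] (0 : ℝ) ≤ 𝓝[≠] 0 := nhdsWithin_mono _ fun _ hx => ne_of_gt hx
  have hlt : 𝓝[<] (0 : ℝ) ≤ 𝓝[≠] 0 := nhdsWithin_mono _ fun _ hx => ne_of_lt hx
  refine ⟨⟨hG.comp_memLp hG0 hu.1, fun k => ?_⟩, fun k du hdu dv => ?_⟩
  · obtain ⟨g, hg, hgk⟩ := hu.2 k
    exact ⟨_, hg.of_le_mul (hR.aestronglyMeasurable hG.continuous hu.1.1 hg.1)
      (.of_forall fun x => hR.norm_le hgt hG _ _), hgk.comp_of_lipschitz hΩ hgt hG hG0 hR⟩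
  · have h1 : HasWeakPartialDeriv Ω k (normPowTrunc α M u) _ :=
      hdu.comp_of_lipschitz hΩ hgt hG hG0 hR
    have h2 : HasWeakPartialDeriv Ω k (normPowTrunc α M u) _ :=
      hdu.comp_of_lipschitz hΩ hlt hG hG0 hR.left_of_right
    -- Both one-sided formulas represent the same weak derivative, so they agree almost everywhere,
    -- which removes the kink term.
    have h3 := (h1.ae_eq hΩ h2).mono fun x hx => normPowTruncRightDeriv_eq 𝕜 hα hM u x (du x) hx
    exact ⟨fun h => (h.ae_eq hΩ h1).trans h3, fun h => h1.congr_ae hΩ (EventuallyEq.trans h3 h.symm)⟩
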